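/- Lemma 5.2. There is a universal constant $C>0$ such that the following holds for every $\alpha>1$. Let $Y_1,\dots,Y_N$ be i.i.d. random vectors in $\mathbb R^d$, and let $X_1,\dots,X_N$ be the observed, possibly contaminated sample: there is a (possibly random) set $\mathcal O\subseteq\{1,\dots,N\}$ such that almost surely $X_i=Y_i$ for all $i\notin\mathcal O$. Let $B_1,\dots,B_K\subseteq\{1,\dots,N\}$, $K\ge 1$, be pairwise disjoint blocks of the same size $m$, chosen independently of the data (hence treated as fixed), and put $\mathbf X_k=(X_i)_{i\in B_k}$, $\mathbf Y_k=(Y_i)_{i\in B_k}$. Let $\mathcal F$ be a class of functions $f:(\mathbb R^d)^m\to\{0,1\}$, and let $$\mathrm{VC}(\mathcal F)=\sup\Bigl\{n:\max_{x_1,\dots,x_n\in(\mathbb R^d)^m}\#\{(f(x_1),\dots,f(x_n)):f\in\mathcal F\}=2^n\Bigr\}.$$ Assume that $\mathcal F$ is measurable for the law $\nu$ of $\mathbf Y_1$, in the sense that every $f\in\mathcal F$ is measurable and that, for all $n$ and $e\in\mathbb R^n$, the function $(x_1,\dots,x_n)\mapsto\sup_{f\in\mathcal F}\bigl|\sum_{i=1}^n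 e_if(x_i)\bigr|$ is measurable with respect to the completion of $\nu^{\otimes n}$. Suppose that * $\mathbb P(f(\mathbf Y_1)=1)\le\frac1{4\alpha}$ for all $f\in\mathcal F$; * almost surely $K\ge C\alpha^2\bigl(\mathrm{VC}(\mathcal F)\vee|\mathcal O|\bigr)$ (in particular $\mathrm{VC}(\mathcal F)<\infty$). Then, with probability at least $1-\exp\bigl(-\frac{K}{8\alpha^2}\bigr)$ (that is, on a measurable event of at least this probability), for every $f\in\mathcal F$ there are at least $\frac{\alpha-1}{\alpha}K$ indices $k\in\{1,\dots,K\}$ with $f(\mathbf X_k)=0$. -/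

import Mathlib

open MeasureTheory ProbabilityTheory
open scoped ENNReal

/-- A Boolean class of functions on `S`: all its members take values in `{0, 1}`. -/
def IsBooleanClass {S : Type*} (F : Set (S → ℝ)) : Prop :=
  ∀ f ∈ F, ∀ x, f x = 0 ∨ f x = 1

/-- The VC dimension of a Boolean class: the supremum (possibly infinite) of the `n` for which
some points `x₁, …, xₙ` satisfy `#{(f x₁, …, f xₙ) : f ∈ F} = 2 ^ n`. -/
noncomputable def vcDimension {S : Type*} (F : Set (S → ℝ)) : ℕ∞ :=
  ⨆ n ∈ {n : ℕ | ∃ x : Fin n → S,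
    ((fun (f : S → ℝ) (i : Fin n) => f (x i)) '' F).ncard = 2 ^ n}, (n : ℕ∞)

/-- `F` is a measurable class for the law `ν` (in the usual sense of empirical process theory):
its members are measurable, and the suprema over `F` of the absolute weighted empirical sums
`|∑ i, e i * f (x i)|` are measurable for the completion of `ν ⊗ ⋯ ⊗ ν`. For a Boolean class,
these suprema are finite. -/
structure IsMeasurableClass {S : Type*} [MeasurableSpace S] (F : Set (S → ℝ)) (ν : Measure S) :
    Prop where
  measurable : ∀ f ∈ F, Measurable f
  aemeasurable_iSup : ∀ (n : ℕ) (e : Fin n → ℝ),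
    AEMeasurable (fun x : Fin n → S => ⨆ f : F, |∑ i, e i * (f : S → ℝ) (x i)|)
      (Measure.pi fun _ : Fin n => ν)

/-- The `k`-th block `(X i)_{i ∈ B k}` of the sample `X`, where the block `B k` has `m` elements
and is listed as `B k 0, …, B k (m - 1)`. -/
def sampleBlock {Ω E : Type*} {N K m : ℕ} (B : Fin K → Fin m → Fin N) (X : Fin N → Ω → E)
    (k : Fin K) (ω : Ω) : Fin m → E :=
  fun j => X (B k j) ω

/-! The budget of `K / α` bad blocks is split: up to `19 / 20` of it for clean blocks that some `f`
hits (`f = 1`), and the rest for contaminated blocks. By disjointness there are at most `#O` of the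
latter, and `#O ≤ K / (1000 α ^ 2)`.

The clean blocks are i.i.d., so it remains to bound the probability that some `f` has at least `t =
19 K / (20 α)` hits. This is done with a ghost sample and multiplicative weights. Patterns on a
double sample get a factor `3 / 2` per hit in the first half and `1 / 2` per hit in the second.
Averaged over exchanges of paired points, each pattern weighs at most `1`
(`sum_patternWeight_swap_le`), so the expected total weight is at most the maximal number of
patterns (`lintegral_traceWeight_le`). Conversely, an `f` with `t` hits in the first half
contributes, after integrating out the ghost half, at least `(3 / 2) ^ t (1 - p / 2) ^ K`, where `p`
bounds the hitting probability. Hence `measure_manyHits_mul_le`. Sauer–Shelah bounds the number of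
patterns (`card_le_of_vcDim_le`), and `tail_estimate` compares the exponents. -/

/-- The patterns on a finite family of points that are cut out by a Boolean class: the sets
`{i | f (x i) = 1}` for `f ∈ F`. -/
noncomputable def traceFamily {S ι : Type*} [Fintype ι] (F : Set (S → ℝ)) (x : ι → S) :
    Finset (Finset ι) :=
  open scoped Classical in
  Finset.univ.filter fun v => ∃ f ∈ F, ∀ i, f (x i) = if i ∈ v then 1 else 0

/-! ### Patterns of a Boolean class: recognition by weighted sums, and Sauer–Shelah -/

section Trace

variable {S ι ι' : Type*} [Fintype ι] [Fintype ι'] {F : Set (S → ℝ)}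

open scoped Classical in
lemma mem_traceFamily {x : ι → S} {v : Finset ι} :
    v ∈ traceFamily F x ↔ ∃ f ∈ F, ∀ i, f (x i) = if i ∈ v then 1 else 0 := by
  simp [traceFamily]

open scoped Classical in
lemma filter_mem_traceFamily (hF : IsBooleanClass F) {f : S → ℝ} (hf : f ∈ F) (x : ι → S) :
    Finset.univ.filter (fun i => f (x i) = 1) ∈ traceFamily F x := by
  rw [mem_traceFamily]
  refine ⟨f, hf, fun i => ?_⟩
  rcases hF f hf (x i) with h | h <;> simp [h]

lemma map_mem_traceFamily_comp (e : ι' ≃ ι) (x : ι → S) (v : Finset ι') :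
    v ∈ traceFamily F (x ∘ e) ↔ v.map e.toEmbedding ∈ traceFamily F x := by
  classical
  rw [mem_traceFamily, mem_traceFamily]
  refine exists_congr fun f => and_congr_right fun _ => ?_
  rw [← e.forall_congr_right]
  simp

/-- A Boolean pattern `v` is recognised by the weights `1` on `v` and `-1 / (n + 1)` off `v`:
among Boolean vectors, only the indicator of `v` gives a weighted sum of absolute value `#v`. -/
lemma abs_weighted_sum_le {n : ℕ} {v w : Finset (Fin n)} (hv : v.Nonempty) (hne : w ≠ v) :
    |∑ i, (if i ∈ v then (1 : ℝ) else -(1 / (n + 1))) * (if i ∈ w then 1 else 0)| ≤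
      (v.card : ℝ) - 1 / (n + 1) := by
  have hsum : ∑ i, (if i ∈ v then (1 : ℝ) else -(1 / (n + 1))) * (if i ∈ w then 1 else 0) =
      ((w ∩ v).card : ℝ) - (w \ v).card / (n + 1) := by
    simp only [mul_ite, mul_one, mul_zero]
    rw [Finset.sum_ite_mem, Finset.univ_inter, Finset.sum_ite]
    simp only [Finset.sum_const, nsmul_eq_mul]
    rw [Finset.filter_mem_eq_inter, ← Finset.sdiff_eq_filter]
    ring
  have hn : (0 : ℝ) < n + 1 := by positivity
  have hr : ((w \ v).card : ℝ) ≤ n := by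
    exact_mod_cast (Finset.card_le_univ _).trans_eq (Fintype.card_fin n)
  have hv1 : (1 : ℝ) ≤ v.card := by exact_mod_cast hv.card_pos
  have hr' : ((w \ v).card : ℝ) / (n + 1) ≤ n / (n + 1) := by gcongr
  have hnn : (n : ℝ) / (n + 1) = 1 - 1 / (n + 1) := by field_simp; ring
  have hr0 : 0 ≤ ((w \ v).card : ℝ) / (n + 1) := by positivity
  have hs0 : 0 ≤ ((w ∩ v).card : ℝ) := by positivity
  have h1 : (1 : ℝ) / (n + 1) ≤ 1 := by
    rw [div_le_one hn]; linarith [(Nat.cast_nonneg n : (0 : ℝ) ≤ n)]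
  rw [hsum, abs_le]
  refine ⟨by linarith, ?_⟩
  -- Either `w` strictly contains `v`, and an extra point costs `1 / (n + 1)`, or `w` misses a point
  -- of `v`, which costs `1`.
  by_cases h : w ∩ v = v
  · have hsub : v ⊆ w := Finset.inter_eq_right.1 h
    have : (w \ v).Nonempty := by
      rw [Finset.sdiff_nonempty]
      exact fun h' => hne (h'.antisymm hsub)
    have h2 : (1 : ℝ) ≤ (w \ v).card := by exact_mod_cast this.card_pos
    have h3 : (1 : ℝ) / (n + 1) ≤ (w \ v).card / (n + 1) := by gcongr
    rw [h]; linarith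
  · have hlt : (w ∩ v).card < v.card :=
      Finset.card_lt_card (Finset.inter_subset_right.ssubset_of_ne h)
    have : ((w ∩ v).card : ℝ) + 1 ≤ v.card := by exact_mod_cast hlt
    linarith

/-- This turns membership of a pattern into a condition on a supremum of the kind that
`IsMeasurableClass` controls. The gap `1 / (n + 1)` is uniform in `f`, so it survives the supremum.
-/
lemma mem_traceFamily_iff_le_iSup (hF : IsBooleanClass F) {n : ℕ} {v : Finset (Fin n)}
    (hv : v.Nonempty) (x : Fin n → S) :
    v ∈ traceFamily F x ↔ (v.card : ℝ) ≤
      ⨆ f : F, |∑ i, (if i ∈ v then (1 : ℝ) else -(1 / (n + 1))) * (f : S → ℝ) (x i)| := by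
  classical
  have hpat : ∀ f ∈ F, ∀ i, f (x i) =
      if i ∈ Finset.univ.filter (fun i => f (x i) = 1) then 1 else 0 := by
    intro f hf i
    rcases hF f hf (x i) with h | h <;> simp [h]
  constructor
  · intro h
    obtain ⟨f, hf, hfx⟩ := mem_traceFamily.1 h
    have hval : |∑ i, (if i ∈ v then (1 : ℝ) else -(1 / (n + 1))) * f (x i)| = v.card := by
      have : ∀ i, (if i ∈ v then (1 : ℝ) else -(1 / (n + 1))) * f (x i) =
          if i ∈ v then 1 else 0 := fun i => by
        rw [hfx i]; by_cases hi : i ∈ v <;> simp [hi]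
      rw [Finset.sum_congr rfl fun i _ => this i]
      simp
    refine hval.ge.trans (le_ciSup (f := fun f : F =>
      |∑ i, (if i ∈ v then (1 : ℝ) else -(1 / (n + 1))) * (f : S → ℝ) (x i)|) ?_ ⟨f, hf⟩)
    refine ⟨∑ i, |if i ∈ v then (1 : ℝ) else -(1 / (n + 1))|, ?_⟩
    rintro _ ⟨g, rfl⟩
    refine (Finset.abs_sum_le_sum_abs _ _).trans (Finset.sum_le_sum fun i _ => ?_)
    rw [abs_mul]
    refine mul_le_of_le_one_right (abs_nonneg _) ?_
    rcases hF g g.2 (x i) with h | h <;> simp [h]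
  · intro h
    by_contra hnot
    have hn : (0 : ℝ) < 1 / (n + 1) := by positivity
    have hv1 : (1 : ℝ) ≤ v.card := by exact_mod_cast hv.card_pos
    have h1 : (1 : ℝ) / (n + 1) ≤ 1 := by
      rw [div_le_one (by positivity)]; linarith [(Nat.cast_nonneg n : (0 : ℝ) ≤ n)]
    have : (⨆ f : F, |∑ i, (if i ∈ v then (1 : ℝ) else -(1 / (n + 1))) * (f : S → ℝ) (x i)|) ≤
        v.card - 1 / (n + 1) := by
      refine Real.iSup_le (fun f => ?_) (by linarith)
      have hw := hpat f f.2
      rw [Finset.sum_congr rfl fun i _ => by rw [hw i]]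
      refine abs_weighted_sum_le hv fun heq => hnot ?_
      rw [mem_traceFamily]
      exact ⟨f, f.2, fun i => by rw [hw i, heq]; congr⟩
    linarith

/-- Sauer–Shelah in the form of a generating function bound. -/
lemma card_le_of_vcDim_le [DecidableEq ι] {A : Finset (Finset ι)} {V : ℕ} (hA : A.vcDim ≤ V)
    {x : ℝ} (hx : 0 < x) (hx1 : x ≤ 1) :
    (A.card : ℝ) ≤ x⁻¹ ^ V * (1 + x) ^ Fintype.card ι := by
  set n := Fintype.card ι
  have h1 : A.card ≤ ∑ k ∈ Finset.Iic V, n.choose k :=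
    (A.card_le_card_shatterer.trans Finset.card_shatterer_le_sum_vcDim).trans
      (Finset.sum_le_sum_of_subset (Finset.Iic_subset_Iic.2 hA))
  have h2 : (A.card : ℝ) ≤ ∑ k ∈ Finset.Iic V, (n.choose k : ℝ) := by exact_mod_cast h1
  have h3 : ∀ k ∈ Finset.Iic V, (n.choose k : ℝ) ≤ x⁻¹ ^ V * (x ^ k * n.choose k) := by
    intro k hk
    have hk' : k ≤ V := Finset.mem_Iic.1 hk
    have : 1 ≤ x⁻¹ ^ V * x ^ k := by
      rw [inv_pow, ← div_eq_inv_mul, one_le_div (by positivity)]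
      exact pow_le_pow_of_le_one hx.le hx1 hk'
    rw [← mul_assoc]
    exact le_mul_of_one_le_left (by positivity) this
  have h4 : ∑ k ∈ Finset.Iic V, x ^ k * (n.choose k : ℝ) ≤ (1 + x) ^ n := by
    rw [add_comm, add_pow]
    simp only [one_pow, mul_one]
    calc _ = ∑ k ∈ (Finset.Iic V).filter (· ≤ n), x ^ k * (n.choose k : ℝ) := by
          rw [Finset.sum_filter]
          refine Finset.sum_congr rfl fun k _ => ?_
          split_ifs with h
          · rfl
          · simp [Nat.choose_eq_zero_of_lt (not_le.1 h)]
      _ ≤ _ := by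
          refine Finset.sum_le_sum_of_subset_of_nonneg (fun k hk => ?_) fun _ _ _ => by positivity
          simp only [Finset.mem_filter] at hk
          simpa [Nat.lt_succ_iff] using hk.2
  calc (A.card : ℝ) ≤ _ := h2
    _ ≤ ∑ k ∈ Finset.Iic V, x⁻¹ ^ V * (x ^ k * n.choose k) := Finset.sum_le_sum h3
    _ = x⁻¹ ^ V * ∑ k ∈ Finset.Iic V, x ^ k * (n.choose k : ℝ) := by rw [Finset.mul_sum]
    _ ≤ _ := by gcongr

lemma vcDim_traceFamily_le [DecidableEq ι] (hF : IsBooleanClass F) {V : ℕ}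
    (hV : vcDimension F ≤ V) (x : ι → S) :
    (traceFamily F x).vcDim ≤ V := by
  classical
  refine Finset.sup_le fun s hs => ?_
  rw [Finset.mem_shatterer] at hs
  have hcard : ((fun (f : S → ℝ) (i : Fin s.card) => f (x (s.equivFin.symm i))) '' F).ncard =
      2 ^ s.card := by
    have himg : (fun (f : S → ℝ) (i : Fin s.card) => f (x (s.equivFin.symm i))) '' F =
        Set.range fun (u : Set (Fin s.card)) (i : Fin s.card) =>
          if i ∈ u then (1 : ℝ) else 0 := by
      ext g
      constructor
      · rintro ⟨f, hf, rfl⟩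
        refine ⟨{i | f (x (s.equivFin.symm i)) = 1}, ?_⟩
        ext i
        rcases hF f hf (x (s.equivFin.symm i)) with h | h <;> simp [h]
      · rintro ⟨u, rfl⟩
        -- Shattering is applied to the copy of `u` inside `s`; the resulting `f` realises `u` on
        -- `s`.
        obtain ⟨t, ht, hst⟩ := hs (t := s.filter fun a => ∃ h : a ∈ s, s.equivFin ⟨a, h⟩ ∈ u)
          (Finset.filter_subset _ _)
        obtain ⟨f, hf, hfx⟩ := mem_traceFamily.1 ht
        refine ⟨f, hf, ?_⟩
        ext i
        have hmem := Finset.ext_iff.1 hst (s.equivFin.symm i : ι)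
        have hi : ((s.equivFin.symm i : s) : ι) ∈ s := (s.equivFin.symm i).2
        simp only [Finset.mem_inter, hi, true_and, Finset.mem_filter, Subtype.coe_eta,
          Equiv.apply_symm_apply, exists_prop] at hmem
        simp only [hfx, hmem]
    rw [himg, ← Set.image_univ, Set.ncard_image_of_injective, Set.ncard_univ,
      Nat.card_eq_fintype_card, Fintype.card_set, Fintype.card_fin]
    intro u u' h
    ext i
    have := congrFun h i
    by_cases h1 : i ∈ u <;> by_cases h2 : i ∈ u' <;> simp_all
  have hle : (s.card : ℕ∞) ≤ vcDimension F :=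
    le_iSup₂ (f := fun (n : ℕ) (_ : n ∈ {n : ℕ | ∃ x : Fin n → S,
      ((fun (f : S → ℝ) (i : Fin n) => f (x i)) '' F).ncard = 2 ^ n}) => (n : ℕ∞))
      s.card ⟨_, hcard⟩
  exact_mod_cast hle.trans hV

end Trace

/-! ### Measurability of pattern events -/

section Measurability

variable {S ι ι' : Type*} [Fintype ι] [Fintype ι'] {F : Set (S → ℝ)} [MeasurableSpace S]
  {ν : Measure S}

lemma measurePreserving_comp_equiv [SigmaFinite ν] (e : ι' ≃ ι) :
    MeasurePreserving (fun x : ι → S => x ∘ e)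
      (Measure.pi fun _ => ν) (Measure.pi fun _ => ν) := by
  have hm : Measurable (fun x : ι → S => x ∘ e) := by
    rw [measurable_pi_iff]; exact fun i => measurable_pi_apply _
  refine ⟨hm, (Measure.pi_eq fun s hs => ?_).symm⟩
  rw [Measure.map_apply hm (MeasurableSet.univ_pi hs)]
  have : (fun x : ι → S => x ∘ e) ⁻¹' Set.univ.pi s = Set.univ.pi fun i => s (e.symm i) := by
    ext x
    simp only [Set.mem_preimage, Set.mem_pi, Set.mem_univ, true_imp_iff, Function.comp]
    rw [← e.forall_congr_right]
    simp
  rw [this, Measure.pi_pi]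
  exact e.symm.prod_comp fun i => ν (s i)

/-- The index type is transported to `Fin n`, where the suprema are measurable. The empty pattern is
excluded because the weights do not detect it. -/
lemma nullMeasurableSet_mem_traceFamily [SigmaFinite ν] (hF : IsBooleanClass F)
    (hM : IsMeasurableClass F ν) {v : Finset ι} (hv : v.Nonempty) :
    NullMeasurableSet {x : ι → S | v ∈ traceFamily F x} (Measure.pi fun _ => ν) := by
  let e := (Fintype.equivFin ι).symm
  have hset : {x : ι → S | v ∈ traceFamily F x} = (fun x : ι → S => x ∘ e) ⁻¹'
      {x | v.map e.symm.toEmbedding ∈ traceFamily F x} := by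
    ext x
    simp only [Set.mem_ofPred_eq, Set.mem_preimage, map_mem_traceFamily_comp, Finset.map_map]
    congr!
    ext i; simp
  rw [hset]
  refine NullMeasurableSet.preimage ?_ (measurePreserving_comp_equiv e).quasiMeasurePreserving
  simp_rw [mem_traceFamily_iff_le_iSup hF (hv.map (f := e.symm.toEmbedding))]
  exact nullMeasurableSet_le aemeasurable_const (hM.aemeasurable_iSup _ _)

end Measurability

/-! ### Symmetrisation with weighted patterns on a double sample -/

section GhostSample

variable {S J : Type*} {F : Set (S → ℝ)}

/-- The permutation of a double sample exchanging the two copies of `j` whenever `σ j`. -/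
def swapSum (σ : J → Bool) : Equiv.Perm (J ⊕ J) :=
  Function.Involutive.toPerm
    (Sum.elim (fun j => if σ j then .inr j else .inl j) (fun j => if σ j then .inl j else .inr j))
    (by rintro (j | j) <;> cases h : σ j <;> simp [h])

lemma swapSum_inl (σ : J → Bool) (j : J) :
    swapSum σ (.inl j) = if σ j then .inr j else .inl j := rfl

lemma swapSum_inr (σ : J → Bool) (j : J) :
    swapSum σ (.inr j) = if σ j then .inl j else .inr j := rfl

lemma swapSum_symm (σ : J → Bool) : (swapSum σ).symm = swapSum σ := rfl

lemma swapSum_apply_self (σ : J → Bool) (i : J ⊕ J) : swapSum σ (swapSum σ i) = i :=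
  (swapSum σ).apply_symm_apply i

variable [Fintype J]

open scoped Classical in
/-- The weight of a pattern on a double sample: hits in the first half count `3 / 2`, hits in the
second half count `1 / 2`. -/
noncomputable def patternWeight (v : Finset (J ⊕ J)) : NNReal :=
  ∏ j, (if .inl j ∈ v then 3 / 2 else 1) * (if .inr j ∈ v then 1 / 2 else 1)

/-- The sum over `σ` factorises over the pairs. A pair contributes `1 + 1` if unhit, `3 / 2 + 1 / 2`
if hit once and `3 / 4 + 3 / 4` if hit twice, so at most `2` each time. -/
lemma sum_patternWeight_swap_le [DecidableEq J] (v : Finset (J ⊕ J)) :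
    ∑ σ : J → Bool, patternWeight (v.map (swapSum σ).toEmbedding) ≤ 2 ^ Fintype.card J := by
  let g : J → Bool → NNReal := fun j b =>
    (if (if b then (.inr j : J ⊕ J) else .inl j) ∈ v then 3 / 2 else 1) *
      (if (if b then (.inl j : J ⊕ J) else .inr j) ∈ v then 1 / 2 else 1)
  have h1 : ∀ σ : J → Bool, patternWeight (v.map (swapSum σ).toEmbedding) = ∏ j, g j (σ j) := by
    intro σ
    refine Finset.prod_congr rfl fun j _ => ?_
    simp only [Finset.mem_map_equiv, swapSum_symm, swapSum_inl, swapSum_inr, g]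
  simp_rw [h1]
  rw [← Fintype.piFinset_univ, ← Finset.prod_univ_sum]
  calc ∏ j, ∑ b, g j b ≤ ∏ _j : J, (2 : NNReal) := by
        refine Finset.prod_le_prod' fun j _ => ?_
        by_cases ha : Sum.inl j ∈ v <;> by_cases hb : Sum.inr j ∈ v <;>
          simp [g, ha, hb, ← NNReal.coe_le_coe] <;> norm_num
    _ = _ := by simp

/-- The total weight of the nonempty patterns cut out on a double sample. -/
noncomputable def traceWeight (F : Set (S → ℝ)) (z : J ⊕ J → S) : ℝ≥0∞ :=
  open scoped Classical in
  ∑ v with v.Nonempty, {z : J ⊕ J → S | v ∈ traceFamily F z}.indicator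
    (fun _ => (patternWeight v : ℝ≥0∞)) z

lemma sum_traceWeight_swap_le [DecidableEq J] (z : J ⊕ J → S) :
    ∑ σ : J → Bool, traceWeight F (z ∘ swapSum σ) ≤
      2 ^ Fintype.card J * ((traceFamily F z).card : ℝ≥0∞) := by
  classical
  have h1 : ∀ σ : J → Bool, traceWeight F (z ∘ swapSum σ) ≤
      ∑ v ∈ traceFamily F z, (patternWeight (v.map (swapSum σ).toEmbedding) : ℝ≥0∞) := by
    intro σ
    unfold traceWeight
    calc _ ≤ ∑ v, {z : J ⊕ J → S | v ∈ traceFamily F z}.indicator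
            (fun _ => (patternWeight v : ℝ≥0∞)) (z ∘ swapSum σ) :=
          Finset.sum_le_sum_of_subset (Finset.filter_subset _ _)
      _ = ∑ v, if v.map (swapSum σ).toEmbedding ∈ traceFamily F z then
            (patternWeight v : ℝ≥0∞) else 0 := by
          refine Finset.sum_congr rfl fun v _ => ?_
          rw [Set.indicator_apply]
          simp only [Set.mem_ofPred_eq, map_mem_traceFamily_comp]
      _ = ∑ v, if v ∈ traceFamily F z then
            (patternWeight (v.map (swapSum σ).toEmbedding) : ℝ≥0∞) else 0 := by
          rw [← (swapSum σ).finsetCongr.sum_comp]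
          refine Finset.sum_congr rfl fun v _ => ?_
          have : (v.map (swapSum σ).toEmbedding).map (swapSum σ).toEmbedding = v := by
            ext i
            simp only [Finset.mem_map_equiv, swapSum_symm, swapSum_apply_self]
          simp only [Equiv.finsetCongr_apply, this]
      _ = _ := by rw [Finset.sum_ite_mem, Finset.univ_inter]
  calc _ ≤ ∑ σ : J → Bool, ∑ v ∈ traceFamily F z,
        (patternWeight (v.map (swapSum σ).toEmbedding) : ℝ≥0∞) :=
        Finset.sum_le_sum fun σ _ => h1 σ
    _ = ∑ v ∈ traceFamily F z, ∑ σ : J → Bool,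
        (patternWeight (v.map (swapSum σ).toEmbedding) : ℝ≥0∞) := Finset.sum_comm
    _ ≤ ∑ v ∈ traceFamily F z, (2 ^ Fintype.card J : ℝ≥0∞) := by
        refine Finset.sum_le_sum fun v _ => ?_
        have := sum_patternWeight_swap_le v
        rw [← ENNReal.coe_le_coe] at this
        push_cast at this
        exact this
    _ = _ := by simp [mul_comm]

variable [MeasurableSpace S] {ν : Measure S}

lemma aemeasurable_traceWeight [SigmaFinite ν] (hF : IsBooleanClass F)
    (hM : IsMeasurableClass F ν) :
    AEMeasurable (traceWeight F) (Measure.pi fun _ : J ⊕ J => ν) := by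
  classical
  unfold traceWeight
  refine Finset.aemeasurable_fun_sum _ fun v hv => ?_
  exact aemeasurable_const.indicator₀
    (nullMeasurableSet_mem_traceFamily hF hM (Finset.mem_filter.1 hv).2)

/-- The product law is invariant under every swap, so the integral equals its average over the `2 ^
#J` swaps, which is bounded pointwise. -/
lemma lintegral_traceWeight_le [IsProbabilityMeasure ν] (hF : IsBooleanClass F)
    (hM : IsMeasurableClass F ν) {M : ℝ≥0∞}
    (hcard : ∀ z : J ⊕ J → S, ((traceFamily F z).card : ℝ≥0∞) ≤ M) :
    ∫⁻ z, traceWeight F z ∂(Measure.pi fun _ : J ⊕ J => ν) ≤ M := by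
  classical
  set μ := Measure.pi fun _ : J ⊕ J => ν
  have hm : AEMeasurable (traceWeight F) μ := aemeasurable_traceWeight hF hM
  have hmp : ∀ σ : J → Bool, MeasurePreserving (fun z : J ⊕ J → S => z ∘ swapSum σ) μ μ :=
    fun σ => measurePreserving_comp_equiv _
  have hswap : ∀ σ : J → Bool,
      ∫⁻ z, traceWeight F (z ∘ swapSum σ) ∂μ = ∫⁻ z, traceWeight F z ∂μ := by
    intro σ
    have hm' : AEMeasurable (traceWeight F) (μ.map fun z : J ⊕ J → S => z ∘ swapSum σ) := by
      rwa [(hmp σ).map_eq]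
    have := lintegral_map' hm' (hmp σ).aemeasurable
    rw [(hmp σ).map_eq] at this
    exact this.symm
  have hsum : (2 ^ Fintype.card J : ℝ≥0∞) * ∫⁻ z, traceWeight F z ∂μ =
      ∫⁻ z, ∑ σ : J → Bool, traceWeight F (z ∘ swapSum σ) ∂μ := by
    rw [lintegral_finsetSum' (f := fun (σ : J → Bool) z => traceWeight F (z ∘ swapSum σ)) _
      fun σ _ => hm.comp_quasiMeasurePreserving (hmp σ).quasiMeasurePreserving]
    simp_rw [hswap]
    simp
  have hle : ∫⁻ z, ∑ σ : J → Bool, traceWeight F (z ∘ swapSum σ) ∂μ ≤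
      2 ^ Fintype.card J * M := by
    calc _ ≤ ∫⁻ _, (2 ^ Fintype.card J * M : ℝ≥0∞) ∂μ :=
          lintegral_mono fun z => (sum_traceWeight_swap_le z).trans (by gcongr; exact hcard z)
      _ = _ := by simp
  rw [← hsum] at hle
  exact (ENNReal.mul_le_mul_iff_right (by simp) (by simp)).1 hle

lemma le_lintegral_prod_half [IsProbabilityMeasure ν] {f : S → ℝ} (hf : Measurable f) {p : ℝ}
    (hp1 : p ≤ 1) (hp : ν.real {x | f x = 1} ≤ p) :
    ENNReal.ofReal ((1 - p / 2) ^ Fintype.card J) ≤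
      ∫⁻ y : J → S, ∏ j, (if f (y j) = 1 then 1 / 2 else 1 : ℝ≥0∞) ∂(Measure.pi fun _ => ν) := by
  classical
  have hset : MeasurableSet {x | f x = 1} := hf (measurableSet_singleton 1)
  let g : S → ℝ≥0∞ := fun x => if f x = 1 then 1 / 2 else 1
  have hg : Measurable g := Measurable.ite hset measurable_const measurable_const
  have hprod : ∫⁻ y : J → S, ∏ j, g (y j) ∂(Measure.pi fun _ => ν) =
      ∏ _j : J, ∫⁻ x, g x ∂ν := by
    rw [lintegral_prod_eq_prod_lintegral_of_indepFun Finset.univ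
      (fun (j : J) (y : J → S) => g (y j))
      (iIndepFun_pi (X := fun _ => g) fun _ => hg.aemeasurable)
      (fun j => hg.comp (measurable_pi_apply j))]
    refine Finset.prod_congr rfl fun j _ => ?_
    exact (measurePreserving_eval (fun _ : J => ν) j).lintegral_comp hg
  change _ ≤ ∫⁻ y : J → S, ∏ j, g (y j) ∂(Measure.pi fun _ => ν)
  rw [hprod, Finset.prod_const, Finset.card_univ, ENNReal.ofReal_pow (by linarith)]
  gcongr
  have h1 : ∫⁻ x, g x ∂ν = 1 / 2 * ν {x | f x = 1} + ν {x | f x = 1}ᶜ := by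
    rw [← lintegral_add_compl g hset]
    rw [setLIntegral_congr_fun (f := g) hset (g := fun _ => 1 / 2) fun x hx => if_pos hx,
      setLIntegral_congr_fun (f := g) hset.compl (g := fun _ => 1) fun x hx => if_neg hx]
    simp
  have h2 : 1 / 2 * ν {x | f x = 1} + ν {x | f x = 1}ᶜ =
      ENNReal.ofReal (1 - ν.real {x | f x = 1} / 2) := by
    rw [← ofReal_measureReal (s := {x | f x = 1}), ← ofReal_measureReal (s := {x | f x = 1}ᶜ),
      probReal_compl_eq_one_sub hset]
    have : (1 / 2 : ℝ≥0∞) = ENNReal.ofReal (1 / 2) := by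
      rw [ENNReal.ofReal_div_of_pos (by norm_num)]; simp
    rw [this, ← ENNReal.ofReal_mul (by norm_num), ← ENNReal.ofReal_add (by positivity)
      (by linarith [measureReal_le_one (μ := ν) (s := {x | f x = 1})])]
    congr 1
    ring
  rw [h1, h2]
  exact ENNReal.ofReal_le_ofReal (by linarith)

open scoped Classical in
/-- The sample points where some member of the class has at least `t` hits. -/
def manyHits (F : Set (S → ℝ)) (t : ℝ) : Set (J → S) :=
  {y | ∃ f ∈ F, t ≤ (Finset.univ.filter fun j => f (y j) = 1).card}

lemma nullMeasurableSet_manyHits [SigmaFinite ν] (hF : IsBooleanClass F)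
    (hM : IsMeasurableClass F ν) {t : ℝ} (ht : 0 < t) :
    NullMeasurableSet (manyHits F t : Set (J → S)) (Measure.pi fun _ => ν) := by
  classical
  have : (manyHits F t : Set (J → S)) =
      ⋃ v ∈ {v : Finset J | t ≤ v.card}, {y | v ∈ traceFamily F y} := by
    ext y
    simp only [manyHits, Set.mem_ofPred_eq, Set.mem_iUnion, exists_prop]
    constructor
    · rintro ⟨f, hf, h⟩
      exact ⟨_, h, filter_mem_traceFamily hF hf y⟩
    · rintro ⟨v, hv, h⟩
      obtain ⟨f, hf, hfx⟩ := mem_traceFamily.1 h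
      refine ⟨f, hf, ?_⟩
      convert hv using 3
      ext j
      simp [hfx]
  rw [this]
  refine NullMeasurableSet.biUnion (Set.to_countable _) fun v hv => ?_
  refine nullMeasurableSet_mem_traceFamily hF hM ?_
  rw [← Finset.card_pos]
  exact_mod_cast ht.trans_le hv

lemma exp_two_fifths_le : Real.exp (2 / 5) ≤ 3 / 2 := by
  -- Fifth powers reduce the claim to `e ^ 2 ≤ 243 / 32`.
  have h : Real.exp (2 / 5) ^ 5 ≤ (3 / 2) ^ 5 := by
    rw [← Real.exp_nat_mul]
    have h1 : ((5 : ℕ) : ℝ) * (2 / 5) = 1 + 1 := by norm_num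
    rw [h1, Real.exp_add]
    have := Real.exp_one_lt_d9
    nlinarith [Real.exp_pos 1]
  exact le_of_pow_le_pow_left₀ (by norm_num) (by norm_num) h

/-- Symmetrisation with a ghost sample: the probability that some member of the class has at
least `t` hits is controlled by the number of patterns on a double sample. -/
theorem measure_manyHits_mul_le [IsProbabilityMeasure ν] (hF : IsBooleanClass F)
    (hM : IsMeasurableClass F ν) {p t : ℝ} (hp1 : p ≤ 1) (ht : 0 < t)
    (hp : ∀ f ∈ F, ν.real {x | f x = 1} ≤ p) {M : ℝ≥0∞}
    (hcard : ∀ z : J ⊕ J → S, ((traceFamily F z).card : ℝ≥0∞) ≤ M) :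
    Measure.pi (fun _ : J => ν) (manyHits F t) *
      ENNReal.ofReal (Real.exp (2 / 5 * t) * (1 - p / 2) ^ Fintype.card J) ≤ M := by
  classical
  refine le_trans ?_ (lintegral_traceWeight_le (J := J) hF hM hcard)
  have hmp := measurePreserving_sumPiEquivProdPi_symm (X := fun _ : J ⊕ J => S) (fun _ => ν)
  have hm : AEMeasurable (traceWeight F) (Measure.pi fun _ : J ⊕ J => ν) :=
    aemeasurable_traceWeight hF hM
  rw [← hmp.map_eq, lintegral_map_equiv, lintegral_prod]
  swap
  · exact hm.comp_quasiMeasurePreserving hmp.quasiMeasurePreserving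
  have hnull := nullMeasurableSet_manyHits (J := J) hF hM ht
  rw [mul_comm, ← lintegral_indicator_const₀ hnull]
  refine lintegral_mono fun y => ?_
  refine Set.indicator_apply_le' (fun hy => ?_) fun _ => zero_le
  obtain ⟨f, hf, hft⟩ := hy
  set n := (Finset.univ.filter fun j => f (y j) = 1).card with hn
  have hn0 : 0 < n := by exact_mod_cast ht.trans_le hft
  have hexp : Real.exp (2 / 5 * t) ≤ (3 / 2) ^ n :=
    calc Real.exp (2 / 5 * t) ≤ Real.exp (n * (2 / 5)) := Real.exp_le_exp.2 (by linarith)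
      _ = Real.exp (2 / 5) ^ n := Real.exp_nat_mul _ _
      _ ≤ _ := by gcongr; exact exp_two_fifths_le
  calc ENNReal.ofReal (Real.exp (2 / 5 * t) * (1 - p / 2) ^ Fintype.card J)
      ≤ ENNReal.ofReal ((3 / 2) ^ n * (1 - p / 2) ^ Fintype.card J) := by
        refine ENNReal.ofReal_le_ofReal (mul_le_mul_of_nonneg_right hexp ?_)
        exact pow_nonneg (by linarith) _
    _ = ENNReal.ofReal ((3 / 2) ^ n) * ENNReal.ofReal ((1 - p / 2) ^ Fintype.card J) :=
        ENNReal.ofReal_mul (by positivity)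
    _ ≤ ENNReal.ofReal ((3 / 2) ^ n) *
        ∫⁻ y' : J → S, ∏ j, (if f (y' j) = 1 then 1 / 2 else 1 : ℝ≥0∞)
          ∂(Measure.pi fun _ => ν) := by
        gcongr
        exact le_lintegral_prod_half (hM.measurable f hf) hp1 (hp f hf)
    _ ≤ ∫⁻ y' : J → S, ENNReal.ofReal ((3 / 2) ^ n) *
          ∏ j, (if f (y' j) = 1 then 1 / 2 else 1 : ℝ≥0∞) ∂(Measure.pi fun _ => ν) :=
        lintegral_const_mul_le _ _
    _ ≤ _ := by
        refine lintegral_mono fun y' => ?_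
        set z : J ⊕ J → S := (MeasurableEquiv.sumPiEquivProdPi fun _ => S).symm (y, y')
        have hzl : ∀ j, z (.inl j) = y j := fun _ => rfl
        have hzr : ∀ j, z (.inr j) = y' j := fun _ => rfl
        set v := Finset.univ.filter fun i => f (z i) = 1 with hv
        have hvmem : v ∈ traceFamily F z := filter_mem_traceFamily hF hf z
        have hvne : v.Nonempty := by
          obtain ⟨j, hj⟩ := Finset.card_pos.1 hn0
          exact ⟨.inl j, by simpa [hv, hzl] using hj⟩
        -- The pattern of this single `f` on the joint sample already carries the required weight;
        -- the other terms of `traceWeight` are dropped.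
        have hw : (patternWeight v : ℝ≥0∞) = ENNReal.ofReal ((3 / 2) ^ n) *
            ∏ j, (if f (y' j) = 1 then 1 / 2 else 1 : ℝ≥0∞) := by
          have h32 : ENNReal.ofReal ((3 / 2) ^ n) = (((3 / 2 : NNReal) ^ n : NNReal) : ℝ≥0∞) := by
            rw [ENNReal.ofReal, ENNReal.coe_inj]
            ext
            rw [Real.coe_toNNReal _ (by positivity)]
            simp
          have hhalf : (∏ j, (if f (y' j) = 1 then 1 / 2 else 1 : ℝ≥0∞)) =
              ((∏ j, (if f (y' j) = 1 then 1 / 2 else 1) : NNReal) : ℝ≥0∞) := by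
            push_cast
            refine Finset.prod_congr rfl fun j _ => ?_
            split_ifs <;> simp
          rw [h32, hhalf, ← ENNReal.coe_mul, ENNReal.coe_inj, patternWeight,
            Finset.prod_mul_distrib]
          congr 1
          · rw [Finset.prod_ite]
            simp [hv, hzl, hn, div_pow]
          · simp [hv, hzr]
        rw [← hw]
        change _ ≤ traceWeight F z
        unfold traceWeight
        refine le_trans ?_ (Finset.single_le_sum (fun _ _ => zero_le)
          (Finset.mem_filter.2 ⟨Finset.mem_univ v, hvne⟩))
        rw [Set.indicator_of_mem (by exact hvmem)]

end GhostSample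

/-! ### Contaminated blocks and the joint law of the clean blocks -/

section Blocks

variable {Ω E : Type*} {N K m : ℕ}

/-- Disjoint blocks: at most as many blocks are contaminated as there are contaminated indices. -/
lemma card_contaminated_blocks_le {B : Fin K → Fin m → Fin N} (hB : Function.Injective2 B)
    (O : Finset (Fin N)) (T : Finset (Fin K)) (hT : ∀ k ∈ T, ∃ j, B k j ∈ O) :
    T.card ≤ O.card := by
  choose j hj using hT
  rw [← Finset.card_attach]
  exact Finset.card_le_card_of_injOn (fun k => B k (j k k.2)) (fun k _ => hj k k.2)
    fun k _ k' _ h => Subtype.ext (hB h).1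

/-- Off the event of many hits, few blocks of the contaminated sample are hit. -/
lemma le_ncard_unhit_blocks {X Y : Fin N → Ω → E} {O : Finset (Fin N)} {ω : Ω}
    (hXY : ∀ i ∉ O, X i ω = Y i ω) {B : Fin K → Fin m → Fin N} (hB : Function.Injective2 B)
    {F : Set ((Fin m → E) → ℝ)} (hF : IsBooleanClass F) {t : ℝ}
    (hω : (fun k => sampleBlock B Y k ω) ∉ manyHits F t) {f : (Fin m → E) → ℝ} (hf : f ∈ F) :
    K - t - O.card ≤ ({k : Fin K | f (sampleBlock B X k ω) = 0}.ncard : ℝ) := by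
  classical
  set H := Finset.univ.filter fun k => f (sampleBlock B Y k ω) = 1 with hH
  have hHt : (H.card : ℝ) ≤ t := by
    by_contra hlt
    refine hω ⟨f, hf, ?_⟩
    convert (not_le.1 hlt).le
  set T := Finset.univ.filter fun k => sampleBlock B X k ω ≠ sampleBlock B Y k ω with hT
  have hTO : T.card ≤ O.card := by
    refine card_contaminated_blocks_le hB O T fun k hk => ?_
    by_contra! h
    exact (Finset.mem_filter.1 hk).2 (funext fun j => hXY _ (h j))
  set Z := Finset.univ.filter fun k => f (sampleBlock B X k ω) = 0 with hZ
  have hcover : (Finset.univ : Finset (Fin K)) ⊆ Z ∪ (H ∪ T) := by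
    intro k _
    simp only [Finset.mem_union, hZ, hH, hT, Finset.mem_filter, Finset.mem_univ, true_and]
    by_cases h : sampleBlock B X k ω = sampleBlock B Y k ω
    · rcases hF f hf (sampleBlock B Y k ω) with h' | h' <;> simp [h, h']
    · exact Or.inr (Or.inr h)
  have hcard : K ≤ Z.card + (H.card + T.card) := by
    have := (Finset.card_le_card hcover).trans (Finset.card_union_le _ _)
    rw [Finset.card_univ, Fintype.card_fin] at this
    exact this.trans (by gcongr; exact Finset.card_union_le _ _)
  have hZc : {k : Fin K | f (sampleBlock B X k ω) = 0}.ncard = Z.card := by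
    rw [← Set.ncard_coe_finset]
    congr 1
    ext k
    simp [hZ]
  have hcard' : (K : ℝ) ≤ Z.card + (H.card + T.card) := by exact_mod_cast hcard
  have hTO' : (T.card : ℝ) ≤ O.card := by exact_mod_cast hTO
  rw [hZc]
  linarith

variable [MeasurableSpace Ω] [MeasurableSpace E] {P : Measure Ω}

lemma measurable_sampleBlock {Y : Fin N → Ω → E} (hY : ∀ i, Measurable (Y i))
    (B : Fin K → Fin m → Fin N) (k : Fin K) : Measurable (sampleBlock B Y k) :=
  measurable_pi_iff.2 fun j => hY (B k j)

/-- Disjoint blocks of an i.i.d. sample are again i.i.d. -/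
lemma map_sampleBlock_eq_pi [IsProbabilityMeasure P] [NeZero K] {Y : Fin N → Ω → E} (hY : ∀ i, Measurable (Y i))
    (hind : iIndepFun Y P) (hid : ∀ i j, IdentDistrib (Y i) (Y j) P P)
    {B : Fin K → Fin m → Fin N} (hB : Function.Injective2 B) :
    P.map (fun ω k => sampleBlock B Y k ω) =
      Measure.pi fun _ : Fin K => P.map (sampleBlock B Y 0) := by
  have hprob : ∀ i, IsProbabilityMeasure (P.map (Y i)) :=
    fun i => Measure.isProbabilityMeasure_map (hY i).aemeasurable
  have hblock : ∀ k, P.map (sampleBlock B Y k) = Measure.pi fun j => P.map (Y (B 0 j)) := by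
    intro k
    have h := (hind.precomp (hB.right k)).map_fun_eq_pi_map fun j => (hY (B k j)).aemeasurable
    refine h.trans ?_
    congr
    ext1 j
    exact (hid _ _).map_eq
  have hinj : Function.Injective fun p : Fin K × Fin m => B p.1 p.2 :=
    fun p q h => Prod.ext (hB h).1 (hB h).2
  have h := (hind.precomp hinj).map_fun_eq_pi_map (fun p : Fin K × Fin m => (hY (B p.1 p.2)).aemeasurable)
  have hlaw : (fun p : Fin K × Fin m => P.map (Y (B p.1 p.2))) =
      fun p => P.map (Y (B 0 p.2)) := by
    ext1 p
    exact (hid _ _).map_eq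
  have hmeas : Measurable fun ω => fun p : Fin K × Fin m => Y (B p.1 p.2) ω :=
    measurable_pi_iff.2 fun p => hY _
  calc P.map (fun ω k => sampleBlock B Y k ω)
      = (P.map fun ω => fun p : Fin K × Fin m => Y (B p.1 p.2) ω).map
          (MeasurableEquiv.curry (Fin K) (Fin m) E) := by
        rw [Measure.map_map (MeasurableEquiv.measurable _) hmeas]
        rfl
    _ = (Measure.pi fun p : Fin K × Fin m => P.map (Y (B 0 p.2))).map
          (MeasurableEquiv.curry (Fin K) (Fin m) E) := by
        rw [← hlaw]
        exact congrArg _ h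
    _ = _ := by
        simp_rw [hblock]
        have := Measure.infinitePi_map_curry (X := E) (ι := Fin K) (κ := Fin m)
          fun _ j => P.map (Y (B 0 j))
        simpa only [Measure.infinitePi_eq_pi] using this

end Blocks

/-! ### Numerical estimates -/

/-- The numerical estimate balancing the hits, the ghost sample and the Sauer–Shelah bound. -/
lemma tail_estimate {α : ℝ} (hα : 1 < α) {K V : ℕ} (hKV : 1000 * α ^ 2 * V ≤ K) {q : ℝ}
    (hq : 0 ≤ q) (h : q * (Real.exp (2 / 5 * (19 / 20 * K / α)) * (1 - 1 / (4 * α) / 2) ^ K) ≤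
      (3 / (100 * α))⁻¹ ^ V * (1 + 3 / (100 * α)) ^ (K + K)) :
    q ≤ Real.exp (-(K : ℝ) / (8 * α ^ 2)) := by
  have hα0 : 0 < α := by linarith
  have hK : (0 : ℝ) ≤ K := Nat.cast_nonneg K
  set u : ℝ := K / α with hu
  have hu0 : 0 ≤ u := by positivity
  -- Here `1 - 1 / (8 α)` is the inverse of `1 + 1 / (8 α - 1)`, and `8 α - 1 ≥ 7 α` since `α > 1`.
  have h1 : Real.exp (-u / 7) ≤ (1 - 1 / (4 * α) / 2) ^ K := by
    have hpos : 0 < 8 * α - 1 := by linarith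
    have e1 : 1 - 1 / (4 * α) / 2 = (1 / (8 * α - 1) + 1)⁻¹ := by
      have : 1 / (8 * α - 1) + 1 = 8 * α / (8 * α - 1) := by
        field_simp
        ring
      rw [this, inv_div]
      field_simp
      ring
    have e2 : 1 / (8 * α - 1) ≤ 1 / (7 * α) := by
      apply one_div_le_one_div_of_le <;> linarith
    have e3 : Real.exp (-(1 / (7 * α))) ≤ 1 - 1 / (4 * α) / 2 := by
      rw [e1, Real.exp_neg]
      refine inv_anti₀ (by positivity) ?_
      exact (Real.add_one_le_exp _).trans (Real.exp_le_exp.2 e2)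
    calc Real.exp (-u / 7) = Real.exp (-(1 / (7 * α))) ^ K := by
          rw [← Real.exp_nat_mul, hu]
          congr 1
          field_simp
      _ ≤ _ := by gcongr
  have h2 : (3 / (100 * α))⁻¹ ^ V ≤ Real.exp (u / 30) := by
    have : (3 / (100 * α))⁻¹ ≤ Real.exp (100 * α / 3) := by
      rw [inv_div]
      linarith [Real.add_one_le_exp (100 * α / 3)]
    calc (3 / (100 * α))⁻¹ ^ V ≤ Real.exp (100 * α / 3) ^ V := by gcongr
      _ = Real.exp (V * (100 * α / 3)) := (Real.exp_nat_mul _ _).symm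
      _ ≤ _ := by
        refine Real.exp_le_exp.2 ?_
        rw [hu, div_div, le_div_iff₀ (by positivity)]
        -- The hypothesis `1000 α ^ 2 V ≤ K` is exactly `V * (100 α / 3) ≤ K / (30 α)`.
        nlinarith
  have h3 : (1 + 3 / (100 * α)) ^ (K + K) ≤ Real.exp (3 / 50 * u) := by
    calc (1 + 3 / (100 * α)) ^ (K + K) ≤ Real.exp (3 / (100 * α)) ^ (K + K) := by
          gcongr
          linarith [Real.add_one_le_exp (3 / (100 * α))]
      _ = _ := by
          rw [← Real.exp_nat_mul, hu]
          congr 1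
          push_cast
          field_simp
          ring
  have h4 : q * Real.exp (19 / 50 * u - u / 7) ≤ Real.exp (u / 30 + 3 / 50 * u) := by
    calc q * Real.exp (19 / 50 * u - u / 7)
        = q * (Real.exp (2 / 5 * (19 / 20 * K / α)) * Real.exp (-u / 7)) := by
          rw [← Real.exp_add, hu]
          congr 2
          ring
      _ ≤ _ := by gcongr
      _ ≤ _ := h
      _ ≤ Real.exp (u / 30) * Real.exp (3 / 50 * u) := by gcongr
      _ = _ := (Real.exp_add _ _).symm
  have h5 : q ≤ Real.exp (u / 30 + 3 / 50 * u - (19 / 50 * u - u / 7)) := by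
    rw [Real.exp_sub, le_div_iff₀ (Real.exp_pos _)]
    exact h4
  refine h5.trans (Real.exp_le_exp.2 ?_)
  -- The net rate `19/50 - 1/7 - 1/30 - 3/50` is about `0.144`, above `1 / 8`; replacing `α` by `α ^
  -- 2` only weakens the bound.
  have h6 : (K : ℝ) / (8 * α ^ 2) ≤ u / 8 := by
    rw [hu, div_div, div_le_div_iff₀ (by positivity) (by positivity)]
    nlinarith [mul_nonneg hK hα0.le]
  rw [neg_div]
  linarith

lemma mul_toNat_le_of_ofReal_mul_toENNReal_le {c : ℝ} (hc : 0 < c) {a : ℕ∞} {K : ℕ}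
    (h : ENNReal.ofReal c * (a : ℝ≥0∞) ≤ K) : ∃ n : ℕ, a = n ∧ c * n ≤ K := by
  induction a using ENat.recTopCoe with
  | top =>
    rw [ENat.toENNReal_top, ENNReal.mul_top (by simpa using hc), top_le_iff] at h
    exact absurd h (ENNReal.natCast_ne_top K)
  | coe n =>
    refine ⟨n, rfl, ?_⟩
    rw [ENat.toENNReal_coe, ← ENNReal.ofReal_natCast n, ← ENNReal.ofReal_mul hc.le,
      ← ENNReal.ofReal_natCast K, ENNReal.ofReal_le_ofReal_iff (Nat.cast_nonneg K)] at h
    exact h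

/-! ### Assembly of the main result -/

theorem lemma5p2 :
    ∃ C : ℝ, 0 < C ∧
      ∀ (α : ℝ), 1 < α →
      ∀ {Ω : Type*} [MeasurableSpace Ω] (P : Measure Ω) [IsProbabilityMeasure P]
        (d N K m : ℕ) [NeZero K]
        -- the clean sample
        (Y : Fin N → Ω → EuclideanSpace ℝ (Fin d)),
        (∀ i, Measurable (Y i)) → iIndepFun Y P → (∀ i j, IdentDistrib (Y i) (Y j) P P) →
      -- the observed sample, which agrees with the clean one off the random set `O`
      ∀ (X : Fin N → Ω → EuclideanSpace ℝ (Fin d)) (O : Ω → Finset (Fin N)),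
        (∀ᵐ ω ∂P, ∀ i ∉ O ω, X i ω = Y i ω) →
      -- `K` pairwise disjoint blocks of `m` indices each
      ∀ (B : Fin K → Fin m → Fin N), Function.Injective2 B →
      ∀ (F : Set ((Fin m → EuclideanSpace ℝ (Fin d)) → ℝ)),
        IsBooleanClass F → IsMeasurableClass F (P.map (sampleBlock B Y 0)) →
        (∀ f ∈ F, P.real {ω | f (sampleBlock B Y 0 ω) = 1} ≤ 1 / (4 * α)) →
        (∀ᵐ ω ∂P, ENNReal.ofReal (C * α ^ 2) *
          ((max (vcDimension F) ((O ω).card : ℕ∞) : ℕ∞) : ℝ≥0∞) ≤ (K : ℝ≥0∞)) →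
        ∃ A : Set Ω, MeasurableSet A ∧ 1 - Real.exp (-(K : ℝ) / (8 * α ^ 2)) ≤ P.real A ∧
          ∀ ω ∈ A, ∀ f ∈ F,
            (α - 1) / α * (K : ℝ) ≤ (({k : Fin K | f (sampleBlock B X k ω) = 0}.ncard : ℕ) : ℝ) := by
  classical
  refine ⟨1000, by norm_num, ?_⟩
  intro α hα Ω _ P _ d N K m _ Y hY hind hid X O hXY B hB F hF hM hp hK
  have hα0 : 0 < α := by linarith
  have hK0 : (0 : ℝ) < K := by exact_mod_cast Nat.pos_of_ne_zero (NeZero.ne K)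
  set ν := P.map (sampleBlock B Y 0) with hν
  have hν1 : IsProbabilityMeasure ν :=
    Measure.isProbabilityMeasure_map (measurable_sampleBlock hY B 0).aemeasurable
  have hbound : ∀ᵐ ω ∂P, ∃ n : ℕ, max (vcDimension F) ((O ω).card : ℕ∞) = n ∧
      1000 * α ^ 2 * n ≤ K := by
    filter_upwards [hK] with ω h
    exact mul_toNat_le_of_ofReal_mul_toENNReal_le (by positivity) h
  -- The VC dimension is deterministic, so a single good `ω` suffices to bound it.
  obtain ⟨V, hV, hKV⟩ : ∃ V : ℕ, vcDimension F ≤ V ∧ 1000 * α ^ 2 * V ≤ K := by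
    obtain ⟨ω, n, hn, hn'⟩ := hbound.exists
    exact ⟨n, hn ▸ le_max_left _ _, hn'⟩
  have hO : ∀ᵐ ω ∂P, 1000 * α ^ 2 * ((O ω).card : ℝ) ≤ K := by
    filter_upwards [hbound] with ω ⟨n, hn, hn'⟩
    have : ((O ω).card : ℕ∞) ≤ n := hn ▸ le_max_right _ _
    have : ((O ω).card : ℝ) ≤ n := by exact_mod_cast this
    exact le_trans (by gcongr) hn'
  set t : ℝ := 19 / 20 * K / α with ht
  have ht0 : 0 < t := by positivity
  have hx : 0 < 3 / (100 * α) := by positivity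
  have hx1 : 3 / (100 * α) ≤ 1 := by rw [div_le_one (by positivity)]; linarith
  have hp1 : 1 / (4 * α) ≤ 1 := by rw [div_le_one (by positivity)]; linarith
  have hpν : ∀ f ∈ F, ν.real {x | f x = 1} ≤ 1 / (4 * α) := by
    intro f hf
    have hset : MeasurableSet {x | f x = 1} :=
      hM.measurable f hf (measurableSet_singleton 1)
    rw [hν, map_measureReal_apply (measurable_sampleBlock hY B 0) hset]
    exact hp f hf
  have hcard : ∀ z : Fin K ⊕ Fin K → (Fin m → EuclideanSpace ℝ (Fin d)),
      ((traceFamily F z).card : ℝ≥0∞) ≤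
        ENNReal.ofReal ((3 / (100 * α))⁻¹ ^ V * (1 + 3 / (100 * α)) ^ (K + K)) := by
    intro z
    rw [← ENNReal.ofReal_natCast]
    refine ENNReal.ofReal_le_ofReal ?_
    simpa using card_le_of_vcDim_le (vcDim_traceFamily_le hF hV z) hx hx1
  have hmain := measure_manyHits_mul_le hF hM hp1 ht0 hpν hcard
  set μ := Measure.pi fun _ : Fin K => ν with hμ
  have htail : μ.real (manyHits F t) ≤ Real.exp (-(K : ℝ) / (8 * α ^ 2)) := by
    refine tail_estimate hα hKV measureReal_nonneg ?_
    rw [← ofReal_measureReal (s := manyHits F t), ← ENNReal.ofReal_mul measureReal_nonneg,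
      ENNReal.ofReal_le_ofReal_iff (by positivity), Fintype.card_fin] at hmain
    exact hmain
  have hYm : Measurable fun ω (k : Fin K) => sampleBlock B Y k ω :=
    measurable_pi_iff.2 fun k => measurable_sampleBlock hY B k
  have hmp : MeasurePreserving (fun ω (k : Fin K) => sampleBlock B Y k ω) P μ :=
    ⟨hYm, map_sampleBlock_eq_pi hY hind hid hB⟩
  have hnull := nullMeasurableSet_manyHits (J := Fin K) hF hM ht0
  set G := (fun ω (k : Fin K) => sampleBlock B Y k ω) ⁻¹' (manyHits F t)ᶜ with hG
  have hGn : NullMeasurableSet G P := hnull.compl.preimage hmp.quasiMeasurePreserving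
  have hPG : P.real G = 1 - μ.real (manyHits F t) := by
    rw [← probReal_compl_eq_one_sub₀ hnull]
    exact congrArg ENNReal.toReal (hmp.measure_preimage hnull.compl)
  set G' := G ∩ {ω | (∀ i ∉ O ω, X i ω = Y i ω) ∧ 1000 * α ^ 2 * ((O ω).card : ℝ) ≤ K} with hG'
  have hGG' : G' =ᵐ[P] G := by
    filter_upwards [hXY, hO] with ω h1 h2
    exact propext (and_iff_left ⟨h1, h2⟩)
  -- The good event is only null measurable, so it is shrunk to a measurable subset of the same
  -- probability.
  obtain ⟨A, hAG, hAm, hAe⟩ := (hGn.congr hGG'.symm).exists_measurable_subset_ae_eq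
  refine ⟨A, hAm, ?_, ?_⟩
  · rw [measureReal_congr (hAe.trans hGG'), hPG]
    linarith
  · intro ω hω f hf
    obtain ⟨hωG, hωXY, hωO⟩ := hAG hω
    refine le_trans ?_ (le_ncard_unhit_blocks hωXY hB hF hωG hf)
    have h1 : ((O ω).card : ℝ) ≤ K / α / 20 := by
      rw [div_div, le_div_iff₀ (by positivity)]
      have : (0 : ℝ) ≤ (O ω).card := Nat.cast_nonneg _
      nlinarith [mul_nonneg this hα0.le, mul_nonneg (mul_nonneg this hα0.le) (sub_pos.2 hα).le]
    have h2 : t = 19 / 20 * (K / α) := by rw [ht]; ring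
    have h3 : (α - 1) / α * (K : ℝ) = K - K / α := by field_simp
    rw [h3, h2]
    linarith
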